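/- Let $n\ge 1$ be an integer and let $\mathbf A$ be an algebra (a set $A$ with finitary basic operations, of an arbitrary signature) that is supernilpotent of degree $n$ and has a Mal'cev term operation $q$, that is, a ternary term operation with $q(x,y,y)=x=q(y,y,x)$ for all $x,y\in A$. Then the clone $\mathrm{Clo}(\mathbf A)$ of term operations of $\mathbf A$ (of all positive arities) is the clone generated by $q$ together with all term operations of $\mathbf A$ of arity at most $n+1$; that is, $\mathrm{Clo}(\mathbf A)$ is the smallest set of finitary operations of positive arity on $A$ that contains these operations and all projections and is closed under composition. Here $\mathbf A$ is supernilpotent of degree $n$ if the $(n+1)$-ary higher (Bulatov) commutator satisfies $[1_{\mathbf A},\dots,1_{\mathbf A}]=0_{\mathbf A}$, where $1_{\mathbf A}$ and $0_{\mathbf A}$ are the full and the equality relation on $A$. For congruences $\alpha_1,\dots,\alpha_{n+1}$, the commutator $[\alpha_1,\dots,\alpha_{n+1}]$ is the smallest congruence $\delta$ such that for every term $t$ whose variables are partitioned into $n+1$ finite blocks, and for all tuples $\mathbf a_i,\mathbf b_i$ of elements of $A$ of the length of the $i$-th block that are coordinatewise $\alpha_i$-related: if $t(\mathbf x_1,\dots,\mathbf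 x_n,\mathbf a_{n+1})\mathrel{\delta}t(\mathbf x_1,\dots,\mathbf x_n,\mathbf b_{n+1})$ for all choices of $\mathbf x_i\in\{\mathbf a_i,\mathbf b_i\}$ $(1\le i\le n)$ except $(\mathbf x_1,\dots,\mathbf x_n)=(\mathbf b_1,\dots,\mathbf b_n)$, then also $t(\mathbf b_1,\dots,\mathbf b_n,\mathbf a_{n+1})\mathrel{\delta}t(\mathbf b_1,\dots,\mathbf b_n,\mathbf b_{n+1})$. -/

import Mathlib

universe u v w

namespace UniversalAlgebra

/-- Finitary operations on `A`: a pair of an arity `k` and a map `A ^ k → A`. -/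
abbrev Operation (A : Type w) : Type w := Σ k : ℕ, ((Fin k → A) → A)

/-- A clone on `A`: a set of operations of positive arity that contains all projections and is
closed under composition. -/
structure IsClone {A : Type w} (C : Set (Operation A)) : Prop where
  arity_pos : ∀ f ∈ C, 0 < f.1
  proj_mem : ∀ (k : ℕ) (i : Fin k), (⟨k, fun x => x i⟩ : Operation A) ∈ C
  comp_mem : ∀ (m k : ℕ) (f : (Fin m → A) → A) (g : Fin m → (Fin k → A) → A),
    (⟨m, f⟩ : Operation A) ∈ C → (∀ j, (⟨k, g j⟩ : Operation A) ∈ C) →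
      (⟨k, fun x => f (fun j => g j x)⟩ : Operation A) ∈ C

/-- The clone generated by a set `G` of operations of positive arity: the intersection of all
clones containing `G`. -/
def generatedClone {A : Type w} (G : Set (Operation A)) : Set (Operation A) :=
  ⋂₀ {C | IsClone C ∧ G ⊆ C}

section Algebra

variable (L : FirstOrder.Language.{u, v}) (A : Type w) [L.Structure A]

/-- The clone of term operations of the algebra `A`: all maps `A ^ k → A`, `k ≥ 1`, induced by
terms in the variables `x₁, …, x_k`. -/
def termClone : Set (Operation A) :=
  {f | 0 < f.1 ∧ ∃ t : L.Term (Fin f.1), ∀ x : Fin f.1 → A, f.2 x = t.realize x}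

variable {A}

/-- A Mal'cev term operation: a ternary term operation `q` with `q(x,y,y) = x = q(y,y,x)`. -/
def IsMalcevTermOperation (q : (Fin 3 → A) → A) : Prop :=
  (⟨3, q⟩ : Operation A) ∈ termClone L A ∧
    ∀ x y : A, q ![x, y, y] = x ∧ q ![y, y, x] = x

/-- An equivalence relation on `A` is a congruence if all basic operations preserve it. -/
def IsCongruence (r : Setoid A) : Prop :=
  ∀ (m : ℕ) (f : L.Functions m) (x y : Fin m → A),
    (∀ i, r (x i) (y i)) → r (FirstOrder.Language.Structure.funMap f x) (FirstOrder.Language.Structure.funMap f y)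

/-- The assignment whose `i`-th block of variables is the tuple `b i` for `i ∈ S` and the tuple
`a i` for `i ∉ S`. -/
def mix {N : ℕ} {k : Fin N → ℕ} (a b : (i : Fin N) → Fin (k i) → A) (S : Finset (Fin N)) :
    (Σ i : Fin N, Fin (k i)) → A :=
  fun p => if p.1 ∈ S then b p.1 p.2 else a p.1 p.2

/-- The relations `α₁, …, αₙ` centralize `α_{n+1}` modulo `δ` (Bulatov's term condition). The
variables of the term `t` are partitioned into `n + 1` blocks; in the `i`-th one, either the tuple
`a i` or the tuple `b i` is substituted, where `a i` and `b i` are coordinatewise `α i`-related.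
If `t(x₁, …, xₙ, a_{n+1}) δ t(x₁, …, xₙ, b_{n+1})` for all `x_i ∈ {a_i, b_i}` except for
`(x₁, …, xₙ) = (b₁, …, bₙ)`, then this holds for `(b₁, …, bₙ)` as well. -/
def Centralizes {n : ℕ} (α : Fin (n + 1) → Setoid A) (δ : Setoid A) : Prop :=
  ∀ (k : Fin (n + 1) → ℕ) (t : L.Term (Σ i : Fin (n + 1), Fin (k i)))
    (a b : (i : Fin (n + 1)) → Fin (k i) → A),
    (∀ i j, α i (a i j) (b i j)) →
    (∀ S : Finset (Fin (n + 1)), Fin.last n ∉ S → S ≠ Finset.univ.erase (Fin.last n) →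
      δ (t.realize (mix a b S)) (t.realize (mix a b (insert (Fin.last n) S)))) →
    δ (t.realize (mix a b (Finset.univ.erase (Fin.last n)))) (t.realize (mix a b Finset.univ))

/-- Bulatov's higher commutator `[α₁, …, α_{n+1}]`: the smallest congruence modulo which
`α₁, …, αₙ` centralize `α_{n+1}`. -/
def commutator {n : ℕ} (α : Fin (n + 1) → Setoid A) : Setoid A :=
  sInf {δ | IsCongruence L δ ∧ Centralizes L α δ}

/-- The infimum in the definition of the commutator is attained. -/
theorem commutator_isLeast {n : ℕ} (α : Fin (n + 1) → Setoid A) :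
    IsLeast {δ : Setoid A | IsCongruence L δ ∧ Centralizes L α δ} (commutator L α) := by
  refine ⟨⟨?_, ?_⟩, fun δ hδ => sInf_le hδ⟩
  · intro m f x y h δ hδ
    exact hδ.1 m f x y fun i => h i δ hδ
  · intro k t a b hab h δ hδ
    exact hδ.2 k t a b hab fun S h1 h2 => h S h1 h2 δ hδ

variable (A)

/-- `A` is supernilpotent of degree `n`: the `(n + 1)`-ary commutator `[1, …, 1]` equals `0`. -/
def IsSupernilpotent (n : ℕ) : Prop :=
  commutator L (fun _ : Fin (n + 1) => (⊤ : Setoid A)) = ⊥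

end Algebra

end UniversalAlgebra

namespace UniversalAlgebra

section Clones

variable {A : Type w}

/-! Fix a `k`-ary term operation `t` and a base variable `x i`. Replacing by `x i` all variables
outside a set `S` with at most `n` elements leaves at most `n + 1` variables, so the result lies in
the generated clone. The Mal'cev operation glues these restrictions into one `g` in that clone
agreeing with `t` on all of them (`exists_mem_eq_on_restrict`). Supernilpotence then forces `t = g`
(`IsSupernilpotent.eq_of_eq_on_restrict`): a larger set of variables splits into `n + 1` blocks, and
agreement at all other vertices of the resulting cube carries over to the top. -/

theorem generatedClone_isClone {G : Set (Operation A)} (hG : ∀ f ∈ G, 0 < f.1) :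
    IsClone (generatedClone G) where
  arity_pos f hf := by
    -- Without `hG` no clone need contain `G`, and the empty intersection would be everything.
    refine hf {f | 0 < f.1} ⟨⟨fun _ h => h, fun k i => i.pos, ?_⟩, hG⟩
    intro m k f g hf hg
    exact hg ⟨0, hf⟩
  proj_mem k i := fun C hC => hC.1.proj_mem k i
  comp_mem m k f g hf hg := fun C hC =>
    hC.1.comp_mem m k f g (hf C hC) fun j => hg j C hC

theorem subset_generatedClone (G : Set (Operation A)) : G ⊆ generatedClone G :=
  fun _ hf _ hC => hC.2 hf

theorem generatedClone_subset {G C : Set (Operation A)} (hC : IsClone C) (hG : G ⊆ C) :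
    generatedClone G ⊆ C :=
  fun _ hf => hf C ⟨hC, hG⟩

theorem termClone_isClone (L : FirstOrder.Language.{u, v}) (A : Type w) [L.Structure A] :
    IsClone (termClone L A) where
  arity_pos _ hf := hf.1
  proj_mem k i := ⟨i.pos, FirstOrder.Language.Term.var i, fun _ => rfl⟩
  comp_mem m k f g hf hg := by
    obtain ⟨hm, t, ht⟩ := hf
    choose hk s hs using hg
    refine ⟨hk ⟨0, hm⟩, t.subst s, fun x => ?_⟩
    rw [FirstOrder.Language.Term.realize_subst]
    exact (ht _).trans (congrArg (fun y => t.realize y) (funext fun j => hs j x))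

theorem IsClone.comp_three {C : Set (Operation A)} (hC : IsClone C) {q : (Fin 3 → A) → A}
    (hq : (⟨3, q⟩ : Operation A) ∈ C) {k : ℕ} {f g h : (Fin k → A) → A}
    (hf : (⟨k, f⟩ : Operation A) ∈ C) (hg : (⟨k, g⟩ : Operation A) ∈ C)
    (hh : (⟨k, h⟩ : Operation A) ∈ C) :
    (⟨k, fun x => q ![f x, g x, h x]⟩ : Operation A) ∈ C := by
  have := hC.comp_mem 3 k q ![f, g, h] hq (by intro j; fin_cases j <;> assumption)
  convert this using 4
  ext j
  fin_cases j <;> rfl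

/-- The tuple `x` with all entries outside `S` replaced by `z`. -/
def restrict {ι : Type*} [DecidableEq ι] (z : A) (S : Finset ι) (x : ι → A) : ι → A :=
  fun j => if j ∈ S then x j else z

theorem restrict_restrict {ι : Type*} [DecidableEq ι] (z : A) (S T : Finset ι) (x : ι → A) :
    restrict z S (restrict z T x) = restrict z (S ∩ T) x := by
  ext j
  by_cases h : j ∈ S <;> by_cases h' : j ∈ T <;> simp [restrict, h, h']

theorem restrict_apply_base {ι : Type*} [DecidableEq ι] (i : ι) (S : Finset ι) (x : ι → A) :
    restrict (x i) S x i = x i := by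
  simp [restrict]

theorem IsClone.restrict_mem {C : Set (Operation A)} (hC : IsClone C) {k : ℕ} (i : Fin k)
    {f : (Fin k → A) → A} (hf : (⟨k, f⟩ : Operation A) ∈ C) (S : Finset (Fin k)) :
    (⟨k, fun x => f (restrict (x i) S x)⟩ : Operation A) ∈ C := by
  refine hC.comp_mem k k f (fun j x => restrict (x i) S x j) hf fun j => ?_
  by_cases hj : j ∈ S
  · simpa [restrict, hj] using hC.proj_mem k j
  · simpa [restrict, hj] using hC.proj_mem k i

/-- If a clone `C` contains all operations of arity at most `n + 1` of a clone `D`, then it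
contains every restriction to at most `n` variables of an operation in `D`. -/
theorem restrict_mem_of_card_le {C D : Set (Operation A)} (hC : IsClone C) (hD : IsClone D)
    {n : ℕ} (h : ∀ f ∈ D, f.1 ≤ n + 1 → f ∈ C) {k : ℕ} (i : Fin k) {f : (Fin k → A) → A}
    (hf : (⟨k, f⟩ : Operation A) ∈ D) {S : Finset (Fin k)} (hS : S.card ≤ n) :
    (⟨k, fun x => f (restrict (x i) S x)⟩ : Operation A) ∈ C := by
  -- Slot `0` holds the base variable, which accounts for the `+ 1` in the arity bound.
  let e : Fin (S.card + 1) → Fin k := Fin.cons i fun m => (S.equivFin.symm m : Fin k)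
  let r : Fin k → Fin (S.card + 1) := fun j => if hj : j ∈ S then (S.equivFin ⟨j, hj⟩).succ else 0
  have h1 : (⟨S.card + 1, fun y => f fun j => y (r j)⟩ : Operation A) ∈ D :=
    hD.comp_mem k _ f (fun j y => y (r j)) hf fun j => hD.proj_mem _ _
  have h2 := hC.comp_mem _ k _ (fun m x => x (e m)) (h _ h1 (by simpa using hS))
    fun m => hC.proj_mem k (e m)
  convert h2 using 4 with x
  ext j
  by_cases hj : j ∈ S <;> simp [restrict, r, e, hj]

/-- Interpolation: with a Mal'cev operation, an operation can be matched on the restrictions to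
the members of a family of sets of variables that is closed under subsets. -/
theorem exists_mem_eq_on_restrict {C : Set (Operation A)} (hC : IsClone C)
    {q : (Fin 3 → A) → A} (hqC : (⟨3, q⟩ : Operation A) ∈ C)
    (hq : ∀ x y : A, q ![x, y, y] = x ∧ q ![y, y, x] = x) {k : ℕ} (i : Fin k)
    (t : (Fin k → A) → A) (F : Finset (Finset (Fin k)))
    (hF : ∀ S ∈ F, ∀ T ⊆ S, T ∈ F)
    (ht : ∀ S ∈ F, (⟨k, fun x => t (restrict (x i) S x)⟩ : Operation A) ∈ C) :
    ∃ g : (Fin k → A) → A, (⟨k, g⟩ : Operation A) ∈ C ∧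
      ∀ S ∈ F, ∀ x, g (restrict (x i) S x) = t (restrict (x i) S x) := by
  revert hF ht
  refine Finset.induction_on_max_value Finset.card F ?_ ?_
  · exact fun _ _ => ⟨_, hC.proj_mem k i, by simp⟩
  · intro S F hSF hmax ih hF ht
    obtain ⟨g, hg, hgt⟩ := ih
      (fun U hU T hT => by
        rcases Finset.mem_insert.1 (hF U (Finset.mem_insert_of_mem hU) T hT) with rfl | h
        · exact absurd (Finset.eq_of_subset_of_card_le hT (hmax U hU) ▸ hU) hSF
        · exact h)
      (fun U hU => ht U (Finset.mem_insert_of_mem hU))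
    -- The new interpolant is `q(g, g_S, t_S)`. On `S` the first two entries cancel. On any other
    -- `T`, maximality of `S` makes `S ∩ T` an earlier set, so the last two cancel.
    refine ⟨_, hC.comp_three hqC hg (hC.restrict_mem i hg S) (ht S (Finset.mem_insert_self _ _)),
      fun T hT x => ?_⟩
    simp only [restrict_apply_base, restrict_restrict]
    rcases Finset.mem_insert.1 hT with rfl | hT'
    · rw [Finset.inter_self, (hq _ _).2]
    · have hne : S ∩ T ≠ S := fun h => hSF <| by
        have hST : S ⊆ T := Finset.inter_eq_left.1 h
        exact Finset.eq_of_subset_of_card_le hST (hmax T hT') ▸ hT'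
      have hmem : S ∩ T ∈ F :=
        (Finset.mem_insert.1 (hF S (Finset.mem_insert_self _ _) _
          Finset.inter_subset_left)).resolve_left hne
      rw [hgt _ hmem, (hq _ _).1, hgt T hT']

end Clones

section Supernilpotent

variable {L : FirstOrder.Language.{u, v}} {A : Type w} [L.Structure A] {n : ℕ}

/-- The term condition of a supernilpotent algebra, for a term in finitely many variables that
are partitioned by a map `φ` into blocks. -/
theorem IsSupernilpotent.term_condition (hA : IsSupernilpotent L A n) {V : Type*} [Fintype V]
    (φ : V → Fin (n + 1)) (t : L.Term V) (a b : V → A)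
    (h : ∀ S : Finset (Fin (n + 1)), Fin.last n ∉ S → S ≠ Finset.univ.erase (Fin.last n) →
      t.realize (fun v => if φ v ∈ S then b v else a v) =
        t.realize (fun v => if φ v ∈ insert (Fin.last n) S then b v else a v)) :
    t.realize (fun v => if φ v ∈ Finset.univ.erase (Fin.last n) then b v else a v) =
      t.realize b := by
  have hc : Centralizes L (fun _ : Fin (n + 1) => (⊤ : Setoid A)) ⊥ :=
    hA ▸ (commutator_isLeast L (fun _ : Fin (n + 1) => (⊤ : Setoid A))).1.2
  -- Every block gets a slot for each variable; only slot `e v` of block `φ v` is used.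
  let e := Fintype.equivFin V
  have key : ∀ S : Finset (Fin (n + 1)),
      (t.relabel fun v => (⟨φ v, e v⟩ : Σ _ : Fin (n + 1), Fin (Fintype.card V))).realize
        (mix (fun _ j => a (e.symm j)) (fun _ j => b (e.symm j)) S) =
      t.realize (fun v => if φ v ∈ S then b v else a v) := by
    intro S
    rw [FirstOrder.Language.Term.realize_relabel]
    congr 1
    ext v
    simp [mix]
  have := hc (fun _ => Fintype.card V) (t.relabel fun v => ⟨φ v, e v⟩)
    (fun _ j => a (e.symm j)) (fun _ j => b (e.symm j)) (fun _ _ => trivial) (fun S h1 h2 => by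
      rw [key, key]
      exact h S h1 h2)
  rw [key, key] at this
  simpa using this

/-- In a supernilpotent Mal'cev algebra, two term operations that agree at all vertices but the
top one of an `(n + 1)`-dimensional cube agree at the top vertex. -/
theorem IsSupernilpotent.eq_at_top (hA : IsSupernilpotent L A n) {q : (Fin 3 → A) → A}
    (hq : IsMalcevTermOperation L q) {k : ℕ} {f g : (Fin k → A) → A}
    (hf : (⟨k, f⟩ : Operation A) ∈ termClone L A) (hg : (⟨k, g⟩ : Operation A) ∈ termClone L A)
    (ψ : Fin k → Fin (n + 1)) (a b : Fin k → A)
    (h : ∀ S : Finset (Fin (n + 1)), S ≠ Finset.univ →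
      f (fun j => if ψ j ∈ S then b j else a j) = g (fun j => if ψ j ∈ S then b j else a j)) :
    f b = g b := by
  obtain ⟨⟨-, u, hu⟩, hq⟩ := hq
  obtain ⟨-, s, hs⟩ := hf
  obtain ⟨-, t, ht⟩ := hg
  dsimp only at u s t hu hs ht
  -- The term is `q(f, g, g')`, where `g'` has its last block frozen at `b` through the `inr`
  -- copies, whose two values are both `b`. Below the top, `f = g` leaves `g'`, which ignores the
  -- last block; at the top edge the values are `g b` and `f b`.
  let w : L.Term (Fin k ⊕ Fin k) := u.subst
    ![s.relabel Sum.inl, t.relabel Sum.inl,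
      t.relabel fun j => if ψ j = Fin.last n then Sum.inr j else Sum.inl j]
  have key : ∀ S : Finset (Fin (n + 1)),
      w.realize (fun v => if Sum.elim ψ ψ v ∈ S then Sum.elim b b v else Sum.elim a b v) =
      q ![f (fun j => if ψ j ∈ S then b j else a j), g (fun j => if ψ j ∈ S then b j else a j),
        g (fun j => if ψ j ∈ insert (Fin.last n) S then b j else a j)] := by
    intro S
    rw [hu, FirstOrder.Language.Term.realize_subst]
    congr 1
    ext m
    fin_cases m
    · simp only [Fin.reduceFinMk, Matrix.cons_val, FirstOrder.Language.Term.realize_relabel, hs]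
      rfl
    · simp only [Fin.reduceFinMk, Matrix.cons_val, FirstOrder.Language.Term.realize_relabel, ht]
      rfl
    · simp only [Fin.reduceFinMk, Matrix.cons_val, FirstOrder.Language.Term.realize_relabel, ht]
      congr 1
      ext j
      by_cases hj : ψ j = Fin.last n <;> simp [hj]
  have main := hA.term_condition (Sum.elim ψ ψ) w (Sum.elim a b) (Sum.elim b b) fun S h1 h2 => by
    have hS : insert (Fin.last n) S ≠ Finset.univ := fun h' => h2 <| by
      rw [← h', Finset.erase_insert h1]
    have hS' : S ≠ Finset.univ := fun h' => h1 (h' ▸ Finset.mem_univ _)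
    rw [key, key, h S hS', h _ hS, Finset.insert_idem, (hq _ _).2, (hq _ _).2]
  have hne : Finset.univ.erase (Fin.last n) ≠ Finset.univ := fun h' =>
    Finset.notMem_erase (Fin.last n) Finset.univ (h'.symm ▸ Finset.mem_univ (Fin.last n) :)
  have top := key Finset.univ
  simp only [Finset.mem_univ, if_true, Finset.mem_insert, or_true] at top
  rw [key, h _ hne, (hq _ _).2, Finset.insert_erase (Finset.mem_univ (Fin.last n))] at main
  simp only [Finset.mem_univ, if_true] at main
  rw [main]
  exact ((hq _ _).1.symm.trans top.symm)

/-- In a supernilpotent Mal'cev algebra of degree `n`, a term operation is determined by its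
restrictions to at most `n` variables. -/
theorem IsSupernilpotent.eq_of_eq_on_restrict (hA : IsSupernilpotent L A n)
    {q : (Fin 3 → A) → A} (hq : IsMalcevTermOperation L q) {k : ℕ} {f g : (Fin k → A) → A}
    (hf : (⟨k, f⟩ : Operation A) ∈ termClone L A) (hg : (⟨k, g⟩ : Operation A) ∈ termClone L A)
    (z : A) (x : Fin k → A)
    (h : ∀ S : Finset (Fin k), S.card ≤ n → f (restrict z S x) = g (restrict z S x)) :
    f x = g x := by
  suffices H : ∀ S : Finset (Fin k), f (restrict z S x) = g (restrict z S x) by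
    simpa +unfoldPartialApp [restrict] using H Finset.univ
  intro S
  induction S using Finset.strongInduction with
  | H S ih =>
    by_cases hS : S.card ≤ n
    · exact h S hS
    obtain ⟨ι⟩ : Nonempty (Fin (n + 1) ↪ S) :=
      Function.Embedding.nonempty_of_card_le (by simp; omega)
    let ε : Fin (n + 1) → Fin k := fun i => ι i
    have hε : Function.Injective ε := Subtype.val_injective.comp ι.injective
    -- `Function.invFun ε` assigns the blocks; block `i` contains `ε i ∈ S`, so omitting it shrinks
    -- `S` strictly.
    refine hA.eq_at_top hq hf hg (Function.invFun ε) (fun _ => z) (restrict z S x) fun T hT => ?_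
    obtain ⟨i, hi⟩ : ∃ i, i ∉ T := by
      by_contra! hc
      exact hT (Finset.eq_univ_of_forall hc)
    have hmix : (fun j => if Function.invFun ε j ∈ T then restrict z S x j else z) =
        restrict z (S.filter fun j => Function.invFun ε j ∈ T) x := by
      ext j
      by_cases h1 : Function.invFun ε j ∈ T <;> by_cases h2 : j ∈ S <;> simp [restrict, h1, h2]
    rw [hmix]
    refine ih _ (Finset.filter_ssubset.2 ⟨ε i, (ι i).2, ?_⟩)
    rwa [Function.leftInverse_invFun hε i]

end Supernilpotent

end UniversalAlgebra

theorem mainTheorem10 (L : FirstOrder.Language.{u, v}) [L.IsAlgebraic]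
    (A : Type w) [L.Structure A] (n : ℕ) (hn : 1 ≤ n)
    (hA : UniversalAlgebra.IsSupernilpotent L A n)
    (q : (Fin 3 → A) → A) (hq : UniversalAlgebra.IsMalcevTermOperation L q) :
    UniversalAlgebra.termClone L A =
      UniversalAlgebra.generatedClone
        ({⟨3, q⟩} ∪ {f | f ∈ UniversalAlgebra.termClone L A ∧ f.1 ≤ n + 1}) := by
  have hD := UniversalAlgebra.termClone_isClone L A
  have hG : ({⟨3, q⟩} ∪ {f | f ∈ UniversalAlgebra.termClone L A ∧ f.1 ≤ n + 1} :
      Set (UniversalAlgebra.Operation A)) ⊆ UniversalAlgebra.termClone L A := by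
    rintro f (rfl | hf)
    exacts [hq.1, hf.1]
  have hC := UniversalAlgebra.generatedClone_isClone fun f hf => hD.arity_pos f (hG hf)
  have hCD := UniversalAlgebra.generatedClone_subset hD hG
  have hGC := UniversalAlgebra.subset_generatedClone
    ({⟨3, q⟩} ∪ {f | f ∈ UniversalAlgebra.termClone L A ∧ f.1 ≤ n + 1})
  refine Set.Subset.antisymm ?_ hCD
  rintro ⟨k, t⟩ ht
  -- The base point is a variable because a constant need not be a term operation.
  let i : Fin k := ⟨0, ht.1⟩
  obtain ⟨g, hg, hgt⟩ := UniversalAlgebra.exists_mem_eq_on_restrict hC (hGC (Or.inl rfl)) hq.2 i t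
    (Finset.univ.filter fun S => S.card ≤ n)
    (fun S hS T hT => by
      simp only [Finset.mem_filter, Finset.mem_univ, true_and] at hS ⊢
      exact (Finset.card_le_card hT).trans hS)
    (fun S hS => UniversalAlgebra.restrict_mem_of_card_le hC hD
      (fun f hf hfn => hGC (Or.inr ⟨hf, hfn⟩)) i ht (by simpa using hS))
  have htg : t = g := funext fun x =>
    hA.eq_of_eq_on_restrict hq ht (hCD hg) (x i) x fun S hS => (hgt S (by simpa using hS) x).symm
  exact htg ▸ hg
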